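/- Let $p$ be a prime and let $F$ be a field of characteristic $p$. A *$p$-mapping* on a Lie algebra $G$ over $F$ is a map $G\to G$, $x\mapsto x^{[p]}$, such that $\operatorname{ad}(a^{[p]})=(\operatorname{ad}a)^p$, $(\alpha a)^{[p]}=\alpha^p a^{[p]}$ and $(a+b)^{[p]}=a^{[p]}+b^{[p]}+\sum_{i=1}^{p-1}s_i(a,b)$ for all $a,b\in G$, $\alpha\in F$, where the $s_i(a,b)\in G$ are determined by $(\operatorname{ad}(a\otimes X+b\otimes 1))^{p-1}(a\otimes 1)=\sum_{i=1}^{p-1} i\,s_i(a,b)\otimes X^{i-1}$ in $G\otimes_F F[X]$. A *$p$-envelope* of a Lie algebra $L$ over $F$ is a triple $(G,[p],i)$ in which $G$ is a Lie algebra over $F$, $[p]$ is a $p$-mapping on $G$, and $i:L\to G$ is an injective Lie algebra homomorphism such that $G$ is the intersection of all Lie subalgebras of $G$ that contain $i(L)$ and are closed under $[p]$. If $L$ is finite-dimensional, a $p$-envelope of $L$ is *minimal* if its dimension is minimal among the dimensions of all $p$-envelopes of $L$. Write $C(G)$ for the center of $G$. **Theorem.** Let $L$ be a finite-dimensional Lie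 algebra over $F$. Then: (1) If $(G_1,[p]_1,i_1)$ and $(G_2,[p]_2,i_2)$ are minimal $p$-envelopes of $L$, then $G_1$ and $G_2$ are isomorphic as (ordinary) Lie algebras. (2) If $(G,[p],i)$ is a finite-dimensional $p$-envelope of $L$, then there exist a Lie subalgebra $H\subseteq G$ with $i(L)\subseteq H$, a $p$-mapping $[p]'$ on $H$ (not necessarily the restriction of $[p]$) such that $(H,[p]',i)$ is a minimal $p$-envelope of $L$, and an ideal $J$ of $G$ with $J\subseteq C(G)$, such that $G=H\oplus J$. (3) A finite-dimensional $p$-envelope $(G,[p],i)$ of $L$ is minimal if and only if $C(G)\subseteq i(L)$. -/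

import Mathlib

open scoped TensorProduct Polynomial

universe u v w w₁ w₂

section PEnvelopes

variable {F : Type u} [Field F]

/-- `s 1, …, s (p - 1)` are the elements `s_i(a, b)` of Jacobson's formula: in `F[X] ⊗ L`,
`(ad (X ⊗ a + 1 ⊗ b)) ^ (p - 1) (1 ⊗ a) = ∑_{i = 1}^{p - 1} i X ^ (i - 1) ⊗ s_i(a, b)`.
In characteristic `p` this identity determines `s 1, …, s (p - 1)`. -/
def IsJacobsonFamily (p : ℕ) {L : Type v} [LieRing L] [LieAlgebra F L]
    (a b : L) (s : ℕ → L) : Prop :=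
  ((LieAlgebra.ad F[X] (F[X] ⊗[F] L)
      ((Polynomial.X : F[X]) ⊗ₜ[F] a + (1 : F[X]) ⊗ₜ[F] b)) ^ (p - 1)) ((1 : F[X]) ⊗ₜ[F] a) =
    ∑ i ∈ Finset.Icc 1 (p - 1), i • ((Polynomial.X ^ (i - 1) : F[X]) ⊗ₜ[F] s i)

/-- `pm : L → L`, `x ↦ x^[p]`, is a `p`-mapping on the Lie algebra `L`; that is, `(L, pm)` is a
restricted Lie algebra. -/
structure IsPMapping (F : Type u) [Field F] (p : ℕ) {L : Type v} [LieRing L] [LieAlgebra F L]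
    (pm : L → L) : Prop where
  ad_map : ∀ a : L, LieAlgebra.ad F L (pm a) = (LieAlgebra.ad F L a) ^ p
  map_smul : ∀ (c : F) (a : L), pm (c • a) = c ^ p • pm a
  map_add : ∀ a b : L, ∃ s : ℕ → L, IsJacobsonFamily (F := F) p a b s ∧
    pm (a + b) = pm a + pm b + ∑ i ∈ Finset.Icc 1 (p - 1), s i

/-- The `p`-subalgebra `S_p` generated by `S`: the intersection of all `p`-subalgebras
containing `S`. -/
def pSubalgebraSpan (F : Type u) [Field F] {G : Type w} [LieRing G] [LieAlgebra F G]
    (pm : G → G) (S : Set G) : LieSubalgebra F G :=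
  sInf {H : LieSubalgebra F G | S ⊆ (H : Set G) ∧ ∀ x ∈ H, pm x ∈ H}

/-- `(G, pm, i)` is a `p`-envelope of `L`. -/
structure IsPEnvelope (p : ℕ) {L : Type v} [LieRing L] [LieAlgebra F L]
    {G : Type w} [LieRing G] [LieAlgebra F G] (pm : G → G) (i : L →ₗ⁅F⁆ G) : Prop where
  isPMapping : IsPMapping F p pm
  injective : Function.Injective i
  span_range : pSubalgebraSpan F pm (Set.range i) = ⊤

/-- `(G, pm, i)` is a minimal `p`-envelope of `L`: its dimension (a cardinal) is minimal among
the dimensions of all `p`-envelopes of `L`. -/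
structure IsMinimalPEnvelope (p : ℕ) {L : Type v} [LieRing L] [LieAlgebra F L]
    {G : Type w} [LieRing G] [LieAlgebra F G] (pm : G → G) (i : L →ₗ⁅F⁆ G) : Prop where
  isPEnvelope : IsPEnvelope p pm i
  rank_le : ∀ (G' : Type w) [LieRing G'] [LieAlgebra F G'] (pm' : G' → G') (i' : L →ₗ⁅F⁆ G'),
    IsPEnvelope p pm' i' → Module.rank F G ≤ Module.rank F G'

end PEnvelopes

/-! In any `p`-envelope all brackets lie in `i(L)`, because `ad` of a `p`-th power is a power of
`ad`. For two envelopes, let `K` be the `p`-subalgebra of `G₁ × G₂` generated by the diagonal copy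
of `L`. It projects onto both factors, and its brackets lie in the diagonal, so any linear section
`G₁ → K` that is diagonal on `L` gives a Lie homomorphism `G₁ → G₂`. Elements `(g, 0)` of `K` have
`g` central; hence the map is injective when `C(G₁) ⊆ i₁(L)`, and such envelopes are minimal
(`exists_lieHom_of_center_subset`). Conversely, a complement `J` of `i(L) ∩ C(G)` in `C(G)` splits
off, leaving an envelope `H` with center in `L` (`exists_isCompl`). Such an `H` is
finite-dimensional, so minimality of `G` forces `H = G`. -/

/-! ### Explicit form of Jacobson's `s_i(a, b)` -/

section JacobsonCoefficients

variable {F : Type u} [Field F]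

/-- The coefficient of `X ^ j` in `(ad (X ⊗ a + 1 ⊗ b)) ^ n (1 ⊗ a)`. -/
def jacobsonCoeff {L : Type v} [LieRing L] (a b : L) : ℕ → ℕ → L
  | 0, 0 => a
  | 0, _ + 1 => 0
  | n + 1, 0 => ⁅b, jacobsonCoeff a b n 0⁆
  | n + 1, j + 1 => ⁅a, jacobsonCoeff a b n j⁆ + ⁅b, jacobsonCoeff a b n (j + 1)⁆

variable {L : Type v} [LieRing L]

theorem jacobsonCoeff_eq_zero_of_lt (a b : L) (n j : ℕ) (h : n < j) :
    jacobsonCoeff a b n j = 0 := by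
  induction n generalizing j with
  | zero =>
    obtain ⟨j, rfl⟩ := Nat.exists_eq_succ_of_ne_zero h.ne'
    simp [jacobsonCoeff]
  | succ n ih =>
    obtain ⟨j, rfl⟩ := Nat.exists_eq_succ_of_ne_zero (Nat.ne_zero_of_lt h)
    simp [jacobsonCoeff, ih j (by omega), ih (j + 1) (by omega)]

/-- The top coefficient is `(ad a) ^ (n + 1) a`. Its vanishing is why Jacobson's sum can stop at `X
^ (p - 2)`. -/
theorem jacobsonCoeff_self (a b : L) (n : ℕ) : jacobsonCoeff a b (n + 1) (n + 1) = 0 := by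
  induction n with
  | zero => simp [jacobsonCoeff]
  | succ n ih =>
    rw [jacobsonCoeff, ih, jacobsonCoeff_eq_zero_of_lt a b (n + 1) (n + 1 + 1) (by omega)]
    simp

theorem jacobsonCoeff_eq_zero_of_lie_eq_zero {a b : L} (h : ⁅b, a⁆ = 0) (n j : ℕ) :
    jacobsonCoeff a b (n + 1) j = 0 := by
  induction n generalizing j with
  | zero => rcases j with _ | _ | j <;> simp [jacobsonCoeff, h]
  | succ n ih =>
    rcases j with _ | j
    · rw [jacobsonCoeff, ih, lie_zero]
    · rw [jacobsonCoeff, ih, ih, lie_zero, lie_zero, add_zero]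

variable [LieAlgebra F L]

theorem map_jacobsonCoeff {M : Type w} [LieRing M] [LieAlgebra F M] (f : L →ₗ⁅F⁆ M) (a b : L)
    (n j : ℕ) : f (jacobsonCoeff a b n j) = jacobsonCoeff (f a) (f b) n j := by
  induction n generalizing j with
  | zero => rcases j with _ | j <;> simp [jacobsonCoeff]
  | succ n ih => rcases j with _ | j <;> simp [jacobsonCoeff, ih]

theorem ad_pow_eq_sum_jacobsonCoeff (a b : L) (n : ℕ) :
    ((LieAlgebra.ad F[X] (F[X] ⊗[F] L)
      ((Polynomial.X : F[X]) ⊗ₜ[F] a + (1 : F[X]) ⊗ₜ[F] b)) ^ n) ((1 : F[X]) ⊗ₜ[F] a) =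
    ∑ j ∈ Finset.range (n + 1), (Polynomial.X ^ j : F[X]) ⊗ₜ[F] jacobsonCoeff a b n j := by
  induction n with
  | zero => simp [jacobsonCoeff]
  | succ n ih =>
    have hb : ∑ j ∈ Finset.range (n + 1),
          (Polynomial.X ^ j : F[X]) ⊗ₜ[F] ⁅b, jacobsonCoeff a b n j⁆ =
        ∑ j ∈ Finset.range (n + 2),
          (Polynomial.X ^ j : F[X]) ⊗ₜ[F] ⁅b, jacobsonCoeff a b n j⁆ := by
      rw [Finset.sum_range_succ _ (n + 1),
        jacobsonCoeff_eq_zero_of_lt a b n (n + 1) (by omega)]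
      simp
    rw [pow_succ', Module.End.mul_apply, ih, map_sum]
    simp only [LieAlgebra.ad_apply, add_lie, LieAlgebra.ExtendScalars.bracket_tmul, one_mul,
      ← pow_succ', Finset.sum_add_distrib]
    rw [hb, Finset.sum_range_succ' _ (n + 1), Finset.sum_range_succ' _ (n + 1)]
    simp only [jacobsonCoeff, TensorProduct.tmul_add, Finset.sum_add_distrib, add_assoc]

/-- The coefficient of `X ^ j`, as a linear map `F[X] ⊗ L → L`. -/
noncomputable def tensorCoeff (F : Type u) [Field F] (L : Type v) [LieRing L] [LieAlgebra F L] (j : ℕ) :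
    F[X] ⊗[F] L →ₗ[F] L :=
  (TensorProduct.lid F L).toLinearMap ∘ₗ (Polynomial.lcoeff F j).rTensor L

theorem tensorCoeff_tmul (j k : ℕ) (x : L) :
    tensorCoeff F L j ((Polynomial.X ^ k : F[X]) ⊗ₜ[F] x) = if j = k then x else 0 := by
  simp only [tensorCoeff, LinearMap.comp_apply, LinearMap.rTensor_tmul, Polynomial.lcoeff_apply,
    Polynomial.coeff_X_pow, LinearEquiv.coe_coe, TensorProduct.lid_tmul]
  split_ifs <;> simp

theorem isJacobsonFamily_iff {p : ℕ} (hp : 2 ≤ p) (a b : L) (s : ℕ → L) :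
    IsJacobsonFamily (F := F) p a b s ↔
      ∀ i ∈ Finset.Icc 1 (p - 1), i • s i = jacobsonCoeff a b (p - 1) (i - 1) := by
  obtain ⟨m, rfl⟩ : ∃ m, p = m + 2 := ⟨p - 2, by omega⟩
  have hs : Finset.Icc 1 (m + 1) = (Finset.range (m + 1)).image (· + 1) := by
    ext x
    simp only [Finset.mem_Icc, Finset.mem_image, Finset.mem_range]
    exact ⟨fun h => ⟨x - 1, by omega, by omega⟩, by rintro ⟨y, hy, rfl⟩; omega⟩
  have hinj : Set.InjOn (· + 1) (Finset.range (m + 1) : Set ℕ) := fun x _ y _ h => by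
    simpa using h
  unfold IsJacobsonFamily
  rw [ad_pow_eq_sum_jacobsonCoeff, show m + 2 - 1 = m + 1 from rfl, hs,
    Finset.sum_range_succ, jacobsonCoeff_self, TensorProduct.tmul_zero, add_zero,
    Finset.sum_image hinj]
  simp only [Finset.forall_mem_image, Nat.add_sub_cancel, ← TensorProduct.tmul_smul]
  constructor
  · intro h j hj
    have := congrArg (tensorCoeff F L j) h
    simp only [map_sum, tensorCoeff_tmul, Finset.sum_ite_eq, hj, if_true] at this
    exact this.symm
  · intro h
    exact Finset.sum_congr rfl fun j hj => by rw [h hj]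

theorem natCast_ne_zero_of_mem_Icc {p : ℕ} [CharP F p] {i : ℕ}
    (hi : i ∈ Finset.Icc 1 (p - 1)) : (i : F) ≠ 0 := by
  rw [Finset.mem_Icc] at hi
  rw [Ne, CharP.cast_eq_zero_iff F p]
  intro h
  have := Nat.le_of_dvd (by omega) h
  omega

/-- The solution of Jacobson's identity. -/
def jacobsonFamily (F : Type u) [Field F] (p : ℕ) {L : Type v} [LieRing L] [LieAlgebra F L]
    (a b : L) (i : ℕ) : L :=
  (i : F)⁻¹ • jacobsonCoeff a b (p - 1) (i - 1)

theorem map_jacobsonFamily (p : ℕ) {M : Type w} [LieRing M] [LieAlgebra F M] (f : L →ₗ⁅F⁆ M)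
    (a b : L) (i : ℕ) : f (jacobsonFamily F p a b i) = jacobsonFamily F p (f a) (f b) i := by
  simp [jacobsonFamily, map_jacobsonCoeff]

theorem isJacobsonFamily_jacobsonFamily (p : ℕ) [hp : Fact p.Prime] [CharP F p] (a b : L) :
    IsJacobsonFamily (F := F) p a b (jacobsonFamily F p a b) := by
  rw [isJacobsonFamily_iff hp.out.two_le]
  intro i hi
  rw [← Nat.cast_smul_eq_nsmul F, jacobsonFamily,
    smul_inv_smul₀ (natCast_ne_zero_of_mem_Icc hi)]

theorem IsJacobsonFamily.eq_jacobsonFamily {p : ℕ} [hp : Fact p.Prime] [CharP F p] {a b : L}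
    {s : ℕ → L} (h : IsJacobsonFamily (F := F) p a b s) {i : ℕ}
    (hi : i ∈ Finset.Icc 1 (p - 1)) : s i = jacobsonFamily F p a b i := by
  rw [isJacobsonFamily_iff hp.out.two_le] at h
  rw [jacobsonFamily, ← h i hi, ← Nat.cast_smul_eq_nsmul F,
    inv_smul_smul₀ (natCast_ne_zero_of_mem_Icc hi)]

theorem jacobsonFamily_eq_zero {p : ℕ} (hp : 2 ≤ p) {a b : L} (h : ⁅b, a⁆ = 0) (i : ℕ) :
    jacobsonFamily F p a b i = 0 := by
  obtain ⟨m, rfl⟩ : ∃ m, p = m + 2 := ⟨p - 2, by omega⟩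
  rw [jacobsonFamily, show m + 2 - 1 = m + 1 from rfl, jacobsonCoeff_eq_zero_of_lie_eq_zero h,
    smul_zero]

theorem IsPMapping.map_add_eq {p : ℕ} [Fact p.Prime] [CharP F p] {pm : L → L}
    (h : IsPMapping F p pm) (a b : L) :
    pm (a + b) = pm a + pm b + ∑ i ∈ Finset.Icc 1 (p - 1), jacobsonFamily F p a b i := by
  obtain ⟨s, hs, e⟩ := h.map_add a b
  rw [e, Finset.sum_congr rfl fun i hi => hs.eq_jacobsonFamily hi]

theorem IsPMapping.map_add_of_lie_eq_zero {p : ℕ} [hp : Fact p.Prime] [CharP F p] {pm : L → L}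
    (h : IsPMapping F p pm) {a b : L} (hab : ⁅b, a⁆ = 0) : pm (a + b) = pm a + pm b := by
  rw [h.map_add_eq, Finset.sum_eq_zero fun i _ => jacobsonFamily_eq_zero hp.out.two_le hab i,
    add_zero]

end JacobsonCoefficients

/-! ### Brackets in a generated `p`-subalgebra -/

section PSubalgebras

variable {F : Type u} [Field F] {p : ℕ} {G : Type w} [LieRing G] [LieAlgebra F G] {pm : G → G}

theorem mem_pSubalgebraSpan {S : Set G} {x : G} : x ∈ pSubalgebraSpan F pm S ↔
    ∀ H : LieSubalgebra F G, (S ⊆ (H : Set G) ∧ ∀ x ∈ H, pm x ∈ H) → x ∈ H := by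
  rw [pSubalgebraSpan, ← SetLike.mem_coe, LieSubalgebra.coe_sInf]
  simp

theorem subset_pSubalgebraSpan (S : Set G) : S ⊆ (pSubalgebraSpan F pm S : Set G) := by
  intro x hx
  rw [SetLike.mem_coe, mem_pSubalgebraSpan]
  exact fun H hH => hH.1 hx

theorem map_mem_pSubalgebraSpan {S : Set G} {x : G} (hx : x ∈ pSubalgebraSpan F pm S) :
    pm x ∈ pSubalgebraSpan F pm S := by
  rw [mem_pSubalgebraSpan] at hx ⊢
  exact fun H hH => hH.2 x (hx H hH)

theorem pSubalgebraSpan_le {S : Set G} {H : LieSubalgebra F G} (hS : S ⊆ (H : Set G))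
    (hH : ∀ x ∈ H, pm x ∈ H) : pSubalgebraSpan F pm S ≤ H :=
  sInf_le ⟨hS, hH⟩

variable {L : Type v} [LieRing L] [LieAlgebra F L] (i : L →ₗ⁅F⁆ G)

/-- Iterated brackets with `g` stay in `range i` if brackets of `g` with `range i` do. -/
theorem ad_pow_mem_range {g : G} (hg : ∀ x, ⁅g, i x⁆ ∈ Set.range i) (n : ℕ) {h : G}
    (hh : h ∈ Set.range i) : ((LieAlgebra.ad F G g) ^ n) h ∈ Set.range i := by
  induction n with
  | zero => simpa using hh
  | succ n ih =>
    rw [pow_succ', Module.End.mul_apply]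
    obtain ⟨y, hy⟩ := ih
    rw [← hy]
    exact hg y

theorem ad_pow_succ_apply (g h : G) (n : ℕ) :
    ((LieAlgebra.ad F G g) ^ (n + 1)) h = ((LieAlgebra.ad F G g) ^ n) ⁅g, h⁆ := by
  rw [pow_succ, Module.End.mul_apply, LieAlgebra.ad_apply]

theorem lie_map_eq (had : ∀ a : G, LieAlgebra.ad F G (pm a) = (LieAlgebra.ad F G a) ^ p)
    (a x : G) : ⁅pm a, x⁆ = ((LieAlgebra.ad F G a) ^ p) x := by
  rw [← had, LieAlgebra.ad_apply]

/-- The normalizer of `i(L)` is a subalgebra closed under `pm` and contains `i(L)`. -/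
theorem lie_mem_range_of_mem_pSubalgebraSpan
    (had : ∀ a : G, LieAlgebra.ad F G (pm a) = (LieAlgebra.ad F G a) ^ p) {k : G}
    (hk : k ∈ pSubalgebraSpan F pm (Set.range i)) (x : L) : ⁅k, i x⁆ ∈ Set.range i := by
  let N : LieSubalgebra F G :=
    { carrier := {g | ∀ x, ⁅g, i x⁆ ∈ i.range}
      add_mem' := fun {a b} ha hb x => by rw [add_lie]; exact add_mem (ha x) (hb x)
      zero_mem' := fun x => by rw [zero_lie]; exact zero_mem _
      smul_mem' := fun c a ha x => by rw [smul_lie]; exact i.range.smul_mem c (ha x)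
      lie_mem' := fun {a b} ha hb x => by
        obtain ⟨y, hy⟩ := ha x
        obtain ⟨z, hz⟩ := hb x
        rw [lie_lie, ← hy, ← hz]
        exact sub_mem (ha z) (hb y) }
  have hN : pSubalgebraSpan F pm (Set.range i) ≤ N := by
    refine pSubalgebraSpan_le ?_ ?_
    · rintro _ ⟨y, rfl⟩ x
      exact ⟨⁅y, x⁆, LieHom.map_lie i y x⟩
    · intro g hg x
      rw [lie_map_eq had]
      exact ad_pow_mem_range i hg p ⟨x, rfl⟩
  exact hN hk x

theorem IsPEnvelope.mem_span {i : L →ₗ⁅F⁆ G} (h : IsPEnvelope p pm i) (g : G) :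
    g ∈ pSubalgebraSpan F pm (Set.range i) := by
  rw [h.span_range]
  exact LieSubalgebra.mem_top g

variable [hp : Fact p.Prime]

/-- Only the `ad` identity is assumed, so that this applies to `Prod.map pm₁ pm₂` without proving it
a `p`-mapping. -/
theorem lie_mem_range_of_mem_of_mem
    (had : ∀ a : G, LieAlgebra.ad F G (pm a) = (LieAlgebra.ad F G a) ^ p) {k l : G}
    (hk : k ∈ pSubalgebraSpan F pm (Set.range i)) (hl : l ∈ pSubalgebraSpan F pm (Set.range i)) :
    ⁅k, l⁆ ∈ Set.range i := by
  have hi (x : L) : i x ∈ pSubalgebraSpan F pm (Set.range i) :=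
    subset_pSubalgebraSpan _ ⟨x, rfl⟩
  let N : LieSubalgebra F G :=
    { carrier := {g | ∀ l ∈ pSubalgebraSpan F pm (Set.range i), ⁅g, l⁆ ∈ i.range}
      add_mem' := fun {a b} ha hb x hx => by
        rw [add_lie]; exact add_mem (ha x hx) (hb x hx)
      zero_mem' := fun x _ => by rw [zero_lie]; exact zero_mem _
      smul_mem' := fun c a ha x hx => by rw [smul_lie]; exact i.range.smul_mem c (ha x hx)
      lie_mem' := fun {a b} ha hb x hx => by
        obtain ⟨y, hy⟩ := ha x hx
        obtain ⟨z, hz⟩ := hb x hx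
        rw [lie_lie, ← hy, ← hz]
        exact sub_mem (ha _ (hi z)) (hb _ (hi y)) }
  have hN : pSubalgebraSpan F pm (Set.range i) ≤ N := by
    refine pSubalgebraSpan_le ?_ ?_
    · rintro _ ⟨y, rfl⟩ x hx
      rw [← lie_skew]
      exact neg_mem (lie_mem_range_of_mem_pSubalgebraSpan i had hx y)
    · intro g hg x hx
      obtain ⟨q, rfl⟩ := Nat.exists_eq_succ_of_ne_zero hp.out.ne_zero
      -- The first of the `p` brackets with `g` lands in `i(L)`; the others stay there.
      rw [lie_map_eq had, ad_pow_succ_apply]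
      exact ad_pow_mem_range i (fun x => hg _ (hi x)) q (hg x hx)
  exact hN hk l hl

theorem lie_eq_zero_of_mem_pSubalgebraSpan
    (had : ∀ a : G, LieAlgebra.ad F G (pm a) = (LieAlgebra.ad F G a) ^ p) {c k : G} {S : Set G}
    (hc : ∀ x ∈ S, ⁅x, c⁆ = 0) (hk : k ∈ pSubalgebraSpan F pm S) : ⁅k, c⁆ = 0 := by
  let N : LieSubalgebra F G :=
    { carrier := {g | ⁅g, c⁆ = 0}
      add_mem' := fun {a b} ha hb => by
        rw [Set.mem_ofPred_eq] at *
        rw [add_lie, ha, hb, add_zero]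
      zero_mem' := zero_lie c
      smul_mem' := fun t a ha => by
        rw [Set.mem_ofPred_eq] at *
        rw [smul_lie, ha, smul_zero]
      lie_mem' := fun {a b} (ha : ⁅a, c⁆ = 0) (hb : ⁅b, c⁆ = 0) => by
        change ⁅⁅a, b⁆, c⁆ = 0
        rw [lie_lie, ha, hb, lie_zero, lie_zero, sub_zero] }
  have hN : pSubalgebraSpan F pm S ≤ N := by
    refine pSubalgebraSpan_le hc ?_
    intro g (hg : ⁅g, c⁆ = 0)
    change ⁅pm g, c⁆ = 0
    obtain ⟨q, rfl⟩ := Nat.exists_eq_succ_of_ne_zero hp.out.ne_zero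
    rw [lie_map_eq had, ad_pow_succ_apply, hg, map_zero]
  exact hN hk

variable {i}

theorem IsPEnvelope.lie_mem_range (h : IsPEnvelope p pm i) (g g' : G) :
    ⁅g, g'⁆ ∈ Set.range i :=
  lie_mem_range_of_mem_of_mem i h.isPMapping.ad_map (h.mem_span g) (h.mem_span g')

theorem IsPEnvelope.mem_center (h : IsPEnvelope p pm i) {c : G} (hc : ∀ x, ⁅i x, c⁆ = 0) :
    c ∈ LieAlgebra.center F G := by
  rw [LieModule.mem_maxTrivSubmodule]
  intro g
  refine lie_eq_zero_of_mem_pSubalgebraSpan h.isPMapping.ad_map ?_ (h.mem_span g)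
  rintro _ ⟨x, rfl⟩
  exact hc x

end PSubalgebras

/-! ### Comparing two envelopes inside their product -/

section Comparison

variable {F : Type u} [Field F] {p : ℕ}
  {L : Type v} [LieRing L] [LieAlgebra F L]
  {G₁ : Type w₁} [LieRing G₁] [LieAlgebra F G₁] {pm₁ : G₁ → G₁} {i₁ : L →ₗ⁅F⁆ G₁}
  {G₂ : Type w₂} [LieRing G₂] [LieAlgebra F G₂] {pm₂ : G₂ → G₂} {i₂ : L →ₗ⁅F⁆ G₂}

theorem ad_pow_prod_apply (a x : G₁ × G₂) (n : ℕ) :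
    ((LieAlgebra.ad F (G₁ × G₂) a) ^ n) x =
      (((LieAlgebra.ad F G₁ a.1) ^ n) x.1, ((LieAlgebra.ad F G₂ a.2) ^ n) x.2) := by
  induction n with
  | zero => simp
  | succ n ih =>
    simp only [pow_succ', Module.End.mul_apply, ih]
    rfl

theorem ad_prodMap (h₁ : IsPMapping F p pm₁) (h₂ : IsPMapping F p pm₂) (a : G₁ × G₂) :
    LieAlgebra.ad F (G₁ × G₂) (Prod.map pm₁ pm₂ a) = (LieAlgebra.ad F (G₁ × G₂) a) ^ p := by
  refine LinearMap.ext fun x => ?_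
  rw [ad_pow_prod_apply, ← h₁.ad_map, ← h₂.ad_map]
  rfl

/-- The `p`-subalgebra of `G₁ × G₂` generated by the diagonal copy of `L`. -/
def pCorrespondence (pm₁ : G₁ → G₁) (i₁ : L →ₗ⁅F⁆ G₁) (pm₂ : G₂ → G₂) (i₂ : L →ₗ⁅F⁆ G₂) :
    LieSubalgebra F (G₁ × G₂) :=
  pSubalgebraSpan F (Prod.map pm₁ pm₂) (Set.range (i₁.prod i₂))

theorem mem_pCorrespondence (x : L) : (i₁ x, i₂ x) ∈ pCorrespondence pm₁ i₁ pm₂ i₂ :=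
  subset_pSubalgebraSpan _ ⟨x, rfl⟩

theorem exists_mem_pCorrespondence_fst (h₁ : IsPEnvelope p pm₁ i₁) (g : G₁) :
    ∃ g', (g, g') ∈ pCorrespondence pm₁ i₁ pm₂ i₂ := by
  have hle : pSubalgebraSpan F pm₁ (Set.range i₁) ≤
      (pCorrespondence pm₁ i₁ pm₂ i₂).map (LieHom.fst F G₁ G₂) := by
    refine pSubalgebraSpan_le ?_ ?_
    · rintro _ ⟨x, rfl⟩
      exact ⟨(i₁ x, i₂ x), mem_pCorrespondence x, rfl⟩
    · rintro _ ⟨k, hk, rfl⟩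
      exact ⟨Prod.map pm₁ pm₂ k, map_mem_pSubalgebraSpan hk, rfl⟩
  obtain ⟨k, hk, rfl⟩ := hle (h₁.mem_span g)
  exact ⟨k.2, hk⟩

theorem exists_mem_pCorrespondence_snd (h₂ : IsPEnvelope p pm₂ i₂) (g' : G₂) :
    ∃ g, (g, g') ∈ pCorrespondence pm₁ i₁ pm₂ i₂ := by
  have hle : pSubalgebraSpan F pm₂ (Set.range i₂) ≤
      (pCorrespondence pm₁ i₁ pm₂ i₂).map (LieHom.snd F G₁ G₂) := by
    refine pSubalgebraSpan_le ?_ ?_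
    · rintro _ ⟨x, rfl⟩
      exact ⟨(i₁ x, i₂ x), mem_pCorrespondence x, rfl⟩
    · rintro _ ⟨k, hk, rfl⟩
      exact ⟨Prod.map pm₁ pm₂ k, map_mem_pSubalgebraSpan hk, rfl⟩
  obtain ⟨k, hk, rfl⟩ := hle (h₂.mem_span g')
  exact ⟨k.1, hk⟩

theorem exists_linearMap_graph_le (h₁ : IsPEnvelope p pm₁ i₁) :
    ∃ f : G₁ →ₗ[F] G₂, (∀ x, f (i₁ x) = i₂ x) ∧
      ∀ g, (g, f g) ∈ pCorrespondence pm₁ i₁ pm₂ i₂ := by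
  let K := pCorrespondence pm₁ i₁ pm₂ i₂
  let π : K.toSubmodule →ₗ[F] G₁ := LinearMap.fst F G₁ G₂ ∘ₗ K.toSubmodule.subtype
  have hπ : LinearMap.range π = ⊤ := by
    rw [LinearMap.range_eq_top]
    intro g
    obtain ⟨g', hg'⟩ := exists_mem_pCorrespondence_fst (pm₂ := pm₂) (i₂ := i₂) h₁ g
    exact ⟨⟨(g, g'), hg'⟩, rfl⟩
  obtain ⟨σ, hσ⟩ := LinearMap.exists_rightInverse_of_surjective π hπ
  obtain ⟨r, hr⟩ := LinearMap.exists_leftInverse_of_injective (i₁ : L →ₗ[F] G₁)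
    (LinearMap.ker_eq_bot.2 h₁.injective)
  have hr' (x : L) : r (i₁ x) = x := LinearMap.congr_fun hr x
  have hσ' (g : G₁) : (σ g : G₁ × G₂).1 = g := LinearMap.congr_fun hσ g
  -- Correct the section `σ` along a complement of `i₁(L)`, so that it becomes diagonal on `i₁(L)`.
  let τ : G₁ →ₗ[F] G₁ × G₂ :=
    K.toSubmodule.subtype ∘ₗ σ ∘ₗ (LinearMap.id - (i₁ : L →ₗ[F] G₁) ∘ₗ r) +
      (i₁.prod i₂ : L →ₗ[F] G₁ × G₂) ∘ₗ r
  have hτ (g : G₁) : τ g = (σ (g - i₁ (r g)) : G₁ × G₂) + (i₁ (r g), i₂ (r g)) := rfl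
  refine ⟨LinearMap.snd F G₁ G₂ ∘ₗ τ, fun x => ?_, fun g => ?_⟩
  · rw [LinearMap.comp_apply, hτ, hr', sub_self, map_zero]
    simp
  · have h1 : (τ g).1 = g := by rw [hτ, Prod.fst_add, hσ']; simp
    have h2 : τ g ∈ K := by
      rw [hτ]
      exact add_mem (σ _).2 (mem_pCorrespondence _)
    have h3 : (g, (τ g).2) = τ g := Prod.ext h1.symm rfl
    rw [LinearMap.comp_apply, LinearMap.snd_apply, h3]
    exact h2

variable [hp : Fact p.Prime]

theorem exists_lie_eq_of_mem_pCorrespondence (h₁ : IsPEnvelope p pm₁ i₁)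
    (h₂ : IsPEnvelope p pm₂ i₂) {k l : G₁ × G₂} (hk : k ∈ pCorrespondence pm₁ i₁ pm₂ i₂)
    (hl : l ∈ pCorrespondence pm₁ i₁ pm₂ i₂) : ∃ x, (i₁ x, i₂ x) = ⁅k, l⁆ :=
  lie_mem_range_of_mem_of_mem (i₁.prod i₂) (ad_prodMap h₁.isPMapping h₂.isPMapping) hk hl

theorem mem_center_of_mem_pCorrespondence_left (h₁ : IsPEnvelope p pm₁ i₁)
    (h₂ : IsPEnvelope p pm₂ i₂) {g : G₁} (hg : (g, 0) ∈ pCorrespondence pm₁ i₁ pm₂ i₂) :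
    g ∈ LieAlgebra.center F G₁ := by
  refine h₁.mem_center fun x => ?_
  obtain ⟨y, hy⟩ := exists_lie_eq_of_mem_pCorrespondence h₁ h₂ (mem_pCorrespondence x) hg
  have hy₁ : i₁ y = ⁅i₁ x, g⁆ := congrArg Prod.fst hy
  have hy₂ : i₂ y = ⁅i₂ x, (0 : G₂)⁆ := congrArg Prod.snd hy
  rw [lie_zero, ← map_zero i₂] at hy₂
  rw [← hy₁, h₂.injective hy₂, map_zero]

theorem mem_center_of_mem_pCorrespondence_right (h₁ : IsPEnvelope p pm₁ i₁)
    (h₂ : IsPEnvelope p pm₂ i₂) {g : G₂} (hg : (0, g) ∈ pCorrespondence pm₁ i₁ pm₂ i₂) :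
    g ∈ LieAlgebra.center F G₂ := by
  refine h₂.mem_center fun x => ?_
  obtain ⟨y, hy⟩ := exists_lie_eq_of_mem_pCorrespondence h₁ h₂ (mem_pCorrespondence x) hg
  have hy₁ : i₁ y = ⁅i₁ x, (0 : G₁)⁆ := congrArg Prod.fst hy
  have hy₂ : i₂ y = ⁅i₂ x, g⁆ := congrArg Prod.snd hy
  rw [lie_zero, ← map_zero i₁] at hy₁
  rw [← hy₂, h₁.injective hy₁, map_zero]

/-- A `p`-envelope whose center lies in `L` embeds, as an ordinary Lie algebra, into every
`p`-envelope of `L`; the embedding is onto if the center of the target also lies in `L`. -/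
theorem exists_lieHom_of_center_subset (h₁ : IsPEnvelope p pm₁ i₁) (h₂ : IsPEnvelope p pm₂ i₂)
    (hc₁ : (LieAlgebra.center F G₁ : Set G₁) ⊆ Set.range i₁) :
    ∃ f : G₁ →ₗ⁅F⁆ G₂, Function.Injective f ∧
      ((LieAlgebra.center F G₂ : Set G₂) ⊆ Set.range i₂ → Function.Surjective f) := by
  obtain ⟨f, hf, hK⟩ := exists_linearMap_graph_le (pm₂ := pm₂) (i₂ := i₂) h₁
  let φ : G₁ →ₗ⁅F⁆ G₂ :=
    { f with
      map_lie' := fun {g h} => by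
        change f ⁅g, h⁆ = ⁅f g, f h⁆
        obtain ⟨x, hx⟩ := exists_lie_eq_of_mem_pCorrespondence h₁ h₂ (hK g) (hK h)
        have hx₁ : i₁ x = ⁅g, h⁆ := congrArg Prod.fst hx
        have hx₂ : i₂ x = ⁅f g, f h⁆ := congrArg Prod.snd hx
        rw [← hx₁, ← hx₂, hf] }
  refine ⟨φ, ?_, fun hc₂ g' => ?_⟩
  · rw [injective_iff_map_eq_zero]
    intro g (hg : f g = 0)
    have hgK := hK g
    rw [hg] at hgK
    obtain ⟨x, rfl⟩ := hc₁ (mem_center_of_mem_pCorrespondence_left h₁ h₂ hgK)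
    rw [hf, ← map_zero i₂] at hg
    rw [h₂.injective hg, map_zero]
  · obtain ⟨g, hg⟩ := exists_mem_pCorrespondence_snd (pm₁ := pm₁) (i₁ := i₁) h₂ g'
    -- The error `g' - f g` is central, hence in `i₂(L)`, which `f` already reaches.
    have hd : (0, g' - f g) ∈ pCorrespondence pm₁ i₁ pm₂ i₂ := by
      have := sub_mem hg (hK g)
      rwa [Prod.mk_sub_mk, sub_self] at this
    obtain ⟨z, hz⟩ := hc₂ (mem_center_of_mem_pCorrespondence_right h₁ h₂ hd)
    refine ⟨g + i₁ z, ?_⟩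
    change f (g + i₁ z) = g'
    rw [_root_.map_add, hf, hz, add_sub_cancel]

end Comparison

/-! ### Splitting off a central ideal; minimality -/

section Splitting

variable {F : Type u} [Field F] {p : ℕ} [hp : Fact p.Prime]
  {L : Type v} [LieRing L] [LieAlgebra F L]
  {G : Type w} [LieRing G] [LieAlgebra F G] {pm : G → G} {i : L →ₗ⁅F⁆ G}

theorem IsPEnvelope.isMinimalPEnvelope (h : IsPEnvelope p pm i)
    (hc : (LieAlgebra.center F G : Set G) ⊆ Set.range i) : IsMinimalPEnvelope p pm i where
  isPEnvelope := h
  rank_le G' _ _ pm' i' h' := by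
    obtain ⟨f, hf, -⟩ := exists_lieHom_of_center_subset h h' hc
    exact LinearMap.rank_le_of_injective (f : G →ₗ[F] G') hf

theorem IsPMapping.map_mem_center [CharP F p] (h : IsPMapping F p pm) {c : G}
    (hc : c ∈ LieAlgebra.center F G) : pm c ∈ LieAlgebra.center F G := by
  rw [LieModule.mem_maxTrivSubmodule] at hc ⊢
  intro x
  obtain ⟨q, hq⟩ := Nat.exists_eq_succ_of_ne_zero hp.out.ne_zero
  rw [← lie_skew, lie_map_eq h.ad_map, hq, ad_pow_succ_apply, ← lie_skew, hc, neg_zero, map_zero,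
    neg_zero]

/-- Every `p`-envelope splits off a central ideal from a `p`-envelope whose center lies in `L`. -/
theorem IsPEnvelope.exists_isCompl [CharP F p] (h : IsPEnvelope p pm i) :
    ∃ (H : LieSubalgebra F G) (J : LieIdeal F G) (pmH : H → H) (iH : L →ₗ⁅F⁆ H),
      (∀ x : L, (iH x : G) = i x) ∧ IsPEnvelope p pmH iH ∧
      (LieAlgebra.center F H : Set H) ⊆ Set.range iH ∧
      J ≤ LieAlgebra.center F G ∧ IsCompl H.toSubmodule J.toSubmodule := by
  let C : Submodule F G := (LieAlgebra.center F G).toSubmodule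
  have memC {c : G} : c ∈ C ↔ ∀ x : G, ⁅x, c⁆ = 0 := LieModule.mem_maxTrivSubmodule F G G c
  let R : Submodule F G := LinearMap.range (i : L →ₗ[F] G)
  obtain ⟨J₀, hJd, hJs⟩ := IsModularLattice.exists_disjoint_and_sup_eq
    (inf_le_right : R ⊓ C ≤ C)
  have hJC : J₀ ≤ C := hJs ▸ le_sup_right
  have hRJ : Disjoint R J₀ := by
    rw [disjoint_iff_inf_le] at hJd ⊢
    exact fun x hx => hJd ⟨⟨hx.1, hJC hx.2⟩, hx.2⟩
  obtain ⟨H₀, hRH, hcompl⟩ := hRJ.exists_isCompl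
  have lieH (a b : G) : ⁅a, b⁆ ∈ H₀ := hRH (h.lie_mem_range a b)
  let H : LieSubalgebra F G := { H₀ with lie_mem' := fun {a b} _ _ => lieH a b }
  let J : LieIdeal F G :=
    { J₀ with
      lie_mem := fun {x m} hm => by
        change ⁅x, m⁆ ∈ J₀
        rw [memC.1 (hJC hm) x]
        exact zero_mem _ }
  let π : G →ₗ[F] H₀ := H₀.projectionOnto J₀ hcompl
  have hπH (x : H₀) : π x = x := Submodule.projectionOnto_apply_left hcompl x
  have hπJ (x : G) : x - (π x : G) ∈ J₀ := by
    rw [← Submodule.ker_projectionOnto hcompl, LinearMap.mem_ker, map_sub]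
    exact sub_eq_zero.2 (hπH (π x)).symm
  have hlieπ (x y : G) : ⁅(π x : G), y⁆ = ⁅x, y⁆ := by
    rw [← sub_eq_zero, ← sub_lie, ← lie_skew, memC.1 (hJC ?_), neg_zero]
    rw [← neg_sub]
    exact neg_mem (hπJ x)
  let iH : L →ₗ⁅F⁆ H :=
    { LinearMap.codRestrict H₀ (i : L →ₗ[F] G) (fun x => hRH ⟨x, rfl⟩) with
      map_lie' := fun {x y} => Subtype.ext (LieHom.map_lie i x y) }
  have hiH (x : L) : (iH x : G) = i x := rfl
  -- `H` need not be closed under `pm`; dropping the `J₀` component changes `pm x` by a central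
  -- element, so `ad` is unaffected.
  let pmH : H → H := fun x => π (pm x)
  have hpmH (x : H) : pm x - (pmH x : G) ∈ J₀ := hπJ _
  have hpow (a x : H) (n : ℕ) : ((((LieAlgebra.ad F H a) ^ n) x : H) : G) =
      ((LieAlgebra.ad F G (a : G)) ^ n) (x : G) := by
    induction n with
    | zero => rfl
    | succ n ih =>
      rw [pow_succ', pow_succ', Module.End.mul_apply, Module.End.mul_apply, ← ih]
      rfl
  have hcenter (c : H) (hc : c ∈ LieAlgebra.center F H) : c ∈ Set.range iH := by
    rw [LieModule.mem_maxTrivSubmodule] at hc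
    -- Commuting with `i(L)` suffices to be central in `G`; then `C = (R ⊓ C) ⊔ J₀` and `H₀ ⊓ J₀ =
    -- ⊥` put `c` in `R`.
    have hcC : (c : G) ∈ C := h.mem_center fun x => congrArg Subtype.val (hc (iH x))
    rw [← hJs] at hcC
    obtain ⟨a, ha, j, hj, hs⟩ := Submodule.mem_sup.1 hcC
    have hjH : j ∈ H₀ := by
      rw [eq_sub_of_add_eq' hs]
      exact sub_mem c.2 (hRH ha.1)
    have hj0 : j = 0 := by
      simpa using hcompl.disjoint.le_bot (Submodule.mem_inf.2 ⟨hjH, hj⟩)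
    obtain ⟨x, hx⟩ := ha.1
    refine ⟨x, Subtype.ext ?_⟩
    rw [hiH, ← hs, hj0, add_zero, ← hx]
    rfl
  refine ⟨H, J, pmH, iH, hiH, ⟨⟨?_, ?_, ?_⟩, ?_, ?_⟩, hcenter, hJC, hcompl⟩
  · intro a
    refine LinearMap.ext fun x => Subtype.ext ?_
    rw [hpow, ← h.isPMapping.ad_map]
    exact hlieπ _ _
  · intro c a
    change π (pm (c • (a : G))) = c ^ p • π (pm a)
    rw [h.isPMapping.map_smul, map_smul]
  · intro a b
    refine ⟨jacobsonFamily F p a b, isJacobsonFamily_jacobsonFamily p a b, ?_⟩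
    change π (pm ((a : G) + (b : G))) = π (pm a) + π (pm b) + _
    rw [h.isPMapping.map_add_eq, _root_.map_add, _root_.map_add, map_sum]
    congr 1
    refine Finset.sum_congr rfl fun j _ => ?_
    rw [← show ((jacobsonFamily F p a b j : H) : G) = jacobsonFamily F p (a : G) (b : G) j from
      map_jacobsonFamily p H.incl a b j]
    exact hπH _
  · exact fun x y hxy => h.injective (congrArg Subtype.val hxy)
  · rw [eq_top_iff]
    intro x _
    rw [mem_pSubalgebraSpan]
    rintro K ⟨hK, hKpm⟩
    let K₀ : Submodule F G := K.toSubmodule.map H₀.subtype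
    have hRK : R ≤ K₀ := by
      rintro _ ⟨x, rfl⟩
      exact ⟨iH x, hK ⟨x, rfl⟩, rfl⟩
    have hCK : C ≤ K₀ ⊔ J₀ := by
      rw [← hJs]
      exact sup_le_sup_right (inf_le_left.trans hRK) _
    -- `K₀ ⊔ J₀` contains `C`, so it is closed under the original `pm` and must be all of `G`;
    -- intersecting with `H₀` gives `K = H`.
    let M : LieSubalgebra F G :=
      { K₀ ⊔ J₀ with
        lie_mem' := fun {a b} _ _ => (hRK.trans le_sup_left) (h.lie_mem_range a b) }
    have hM : pSubalgebraSpan F pm (Set.range i) ≤ M := by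
      refine pSubalgebraSpan_le ?_ ?_
      · rintro _ ⟨x, rfl⟩
        exact (hRK.trans le_sup_left) ⟨x, rfl⟩
      · intro y hy
        obtain ⟨_, ⟨k, hk, rfl⟩, j, hj, rfl⟩ := Submodule.mem_sup.1 (show y ∈ K₀ ⊔ J₀ from hy)
        change pm ((k : G) + j) ∈ K₀ ⊔ J₀
        rw [h.isPMapping.map_add_of_lie_eq_zero
          (by rw [← lie_skew, memC.1 (hJC hj), neg_zero])]
        refine add_mem ?_ (hCK (h.isPMapping.map_mem_center (hJC hj)))
        rw [← sub_add_cancel (pm (k : G)) (pmH k : G)]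
        exact add_mem (Submodule.mem_sup_right (hpmH k))
          (Submodule.mem_sup_left ⟨pmH k, hKpm k hk, rfl⟩)
    obtain ⟨_, ⟨k, hk, rfl⟩, j, hj, hs⟩ :=
      Submodule.mem_sup.1 (show (x : G) ∈ K₀ ⊔ J₀ from hM (h.mem_span x))
    have hjH : j ∈ H₀ := by
      rw [eq_sub_of_add_eq' hs]
      exact sub_mem x.2 k.2
    have hj0 : j = 0 := by
      simpa using hcompl.disjoint.le_bot (Submodule.mem_inf.2 ⟨hjH, hj⟩)
    have hxk : k = x := Subtype.ext (by rw [← hs, hj0, add_zero]; rfl)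
    exact hxk ▸ hk

/-- A `p`-envelope of a finite-dimensional Lie algebra is finite-dimensional if its center lies
in `L`. -/
theorem IsPEnvelope.finite_of_center_subset [Module.Finite F L] (h : IsPEnvelope p pm i)
    (hc : (LieAlgebra.center F G : Set G) ⊆ Set.range i) : Module.Finite F G := by
  let R : Submodule F G := LinearMap.range (i : L →ₗ[F] G)
  obtain ⟨r, hr⟩ := LinearMap.exists_leftInverse_of_injective (i : L →ₗ[F] G)
    (LinearMap.ker_eq_bot.2 h.injective)
  have hr' (x : L) : r (i x) = x := LinearMap.congr_fun hr x
  -- `θ g = (r ∘ ad g ∘ i, r g)`: the first component vanishes only on central `g`, and `r` is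
  -- injective on `i(L)`.
  let θ : G →ₗ[F] (L →ₗ[F] L) × L :=
    ((LinearMap.compr₂ (LieAlgebra.ad F G : G →ₗ[F] Module.End F G) r).compl₂
      (i : L →ₗ[F] G)).prod r
  refine Module.Finite.of_injective θ ((injective_iff_map_eq_zero θ).2 fun g hg => ?_)
  have hg₁ (x : L) : r ⁅g, i x⁆ = 0 := LinearMap.congr_fun (congrArg Prod.fst hg) x
  have hg₂ : r g = 0 := congrArg Prod.snd hg
  have hgc : g ∈ LieAlgebra.center F G := h.mem_center fun x => by
    obtain ⟨y, hy⟩ := h.lie_mem_range g (i x)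
    have hy0 := hg₁ x
    rw [← hy, hr'] at hy0
    rw [← lie_skew, ← hy, hy0, map_zero, neg_zero]
  obtain ⟨x, rfl⟩ := hc hgc
  rw [hr'] at hg₂
  rw [hg₂, map_zero]

theorem IsMinimalPEnvelope.center_subset [CharP F p] [Module.Finite F L]
    (h : IsMinimalPEnvelope p pm i) : (LieAlgebra.center F G : Set G) ⊆ Set.range i := by
  obtain ⟨H, J, pmH, iH, hiH, hH, hcH, -, hcompl⟩ := h.isPEnvelope.exists_isCompl
  have hfinH : Module.Finite F H.toSubmodule := hH.finite_of_center_subset hcH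
  have hle : Module.rank F G ≤ Module.rank F H.toSubmodule := h.rank_le H pmH iH hH
  have hfin : Module.Finite F G :=
    Module.rank_lt_aleph0_iff.1 (hle.trans_lt (Module.rank_lt_aleph0 F H.toSubmodule))
  have htop : H.toSubmodule = ⊤ := by
    refine Submodule.eq_top_of_finrank_eq (le_antisymm (Submodule.finrank_le _) ?_)
    rw [← Module.finrank_eq_rank F G, ← Module.finrank_eq_rank F H.toSubmodule] at hle
    exact_mod_cast hle
  intro c hc
  have hcmem : c ∈ H.toSubmodule := htop ▸ Submodule.mem_top
  have hcc : (⟨c, hcmem⟩ : H) ∈ LieAlgebra.center F H := by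
    rw [LieModule.mem_maxTrivSubmodule]
    intro x
    exact Subtype.ext ((LieModule.mem_maxTrivSubmodule F G G c).1 hc x)
  obtain ⟨x, hx⟩ := hcH hcc
  exact ⟨x, by rw [← hiH, hx]⟩

end Splitting

theorem mainTheorem9 (p : ℕ) [Fact p.Prime] (F : Type u) [Field F] [CharP F p]
    (L : Type v) [LieRing L] [LieAlgebra F L] [Module.Finite F L] :
    -- (1) any two minimal `p`-envelopes are isomorphic as Lie algebras
    (∀ (G₁ : Type w₁) [LieRing G₁] [LieAlgebra F G₁] (pm₁ : G₁ → G₁) (i₁ : L →ₗ⁅F⁆ G₁)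
        (G₂ : Type w₂) [LieRing G₂] [LieAlgebra F G₂] (pm₂ : G₂ → G₂) (i₂ : L →ₗ⁅F⁆ G₂),
        IsMinimalPEnvelope p pm₁ i₁ → IsMinimalPEnvelope p pm₂ i₂ →
        Nonempty (G₁ ≃ₗ⁅F⁆ G₂)) ∧
    -- (2) every finite-dimensional `p`-envelope splits off a central ideal from a minimal one
    (∀ (G : Type w) [LieRing G] [LieAlgebra F G] [Module.Finite F G] (pm : G → G)
        (i : L →ₗ⁅F⁆ G), IsPEnvelope p pm i →
        ∃ (H : LieSubalgebra F G) (J : LieIdeal F G) (pmH : H → H) (iH : L →ₗ⁅F⁆ H),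
          (∀ x : L, (iH x : G) = i x) ∧
          IsMinimalPEnvelope p pmH iH ∧
          J ≤ LieAlgebra.center F G ∧
          IsCompl H.toSubmodule J.toSubmodule) ∧
    -- (3) minimality criterion
    (∀ (G : Type w) [LieRing G] [LieAlgebra F G] [Module.Finite F G] (pm : G → G)
        (i : L →ₗ⁅F⁆ G), IsPEnvelope p pm i →
        (IsMinimalPEnvelope p pm i ↔
          (LieAlgebra.center F G : Set G) ⊆ Set.range i)) := by
  refine ⟨?_, ?_, ?_⟩
  · intro G₁ _ _ pm₁ i₁ G₂ _ _ pm₂ i₂ h₁ h₂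
    -- The center criterion replaces a comparison of dimensions, so `G₁` and `G₂` may live in
    -- different universes.
    obtain ⟨f, hf, hs⟩ := exists_lieHom_of_center_subset h₁.isPEnvelope h₂.isPEnvelope
      h₁.center_subset
    exact ⟨LieEquiv.ofBijective f ⟨hf, hs h₂.center_subset⟩⟩
  · intro G _ _ _ pm i h
    obtain ⟨H, J, pmH, iH, hiH, hH, hcH, hJ, hcompl⟩ := h.exists_isCompl
    exact ⟨H, J, pmH, iH, hiH, hH.isMinimalPEnvelope hcH, hJ, hcompl⟩
  · intro G _ _ _ pm i h
    exact ⟨fun hm => hm.center_subset, fun hc => h.isMinimalPEnvelope hc⟩
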